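/- **Theorem (risk of the Guaranteed Error Machine, bounds from below and from above).** *Setting.* Let $\mathcal X$ be a measurable space equipped with a total order (used only to break ties), $\mathcal H$ a real Hilbert space and $\varphi:\mathcal X\to\mathcal H$ a feature map such that $(x,x')\mapsto\|\varphi(x)-\varphi(x')\|$ is measurable on $\mathcal X\times\mathcal X$. An example is a pair $z=(x,y)\in\mathcal X\times\{-1,1\}$. Fix an integer $d\ge 1$ and an additional example $(\bar x,\bar y)$. Let $N\ge1$ and let $\boldsymbol z_1,\dots,\boldsymbol z_N$ be independent, identically distributed random examples; $\boldsymbol z=(\boldsymbol x,\boldsymbol y)$ denotes a random example with the same distribution, and $\boldsymbol S$ the multiset formed by $\boldsymbol z_1,\dots,\boldsymbol z_N$. *The algorithm.* Given a finite multiset $S$ of examples, GEM proceeds as follows. 0. Set $q:=0$, let $P$ be $S$ with one copy of $(\bar x,\bar y)$ added, $C:=\emptyset$, $(x_C,y_C):=(\bar x,\bar y)$. 1. Set $q:=q+1$ and let $r^*\in[0,+\infty]$ be the largest $r$ such that $\|\varphi(x_i)-\varphi(x_C)\|\ge r$ for all $(x_i,y_i)\in P$ with $y_i\ne y_C$. 2.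 Let $\mathcal R_q:=\{x\in\mathcal X:\|\varphi(x)-\varphi(x_C)\|<r^*\}$ and $\ell_q:=y_C$. If $r^*>0$, remove from $P$ all examples whose instance lies in $\mathcal R_q$; if $r^*=0$, remove from $P$ one copy of $(x_C,y_C)$. 3. If $r^*<+\infty$, let $(x_{i^*},y_{i^*})$ be an example of $P$ with $\|\varphi(x_{i^*})-\varphi(x_C)\|=r^*$ and $y_{i^*}\neq y_C$ whose instance is smallest in the order of $\mathcal X$ among all such examples; add one copy of it to $C$ and set $(x_C,y_C):=(x_{i^*},y_{i^*})$. 4. If $|C|=d$ or $P=\emptyset$, stop; otherwise go to 1. The compression is $\mathsf c_{\mathrm{GEM}}(S)=C$ (a multiset, with cardinality $|C|$ counted with multiplicity). The predictor $\mathcal A_{\mathrm{GEM}}(S):\mathcal X\to\{-1,0,1\}$ maps $x$ to $\ell_j$ for the smallest $j$ with $x\in\mathcal R_j$, and to $0$ if there is no such $j$. The risk of $h:\mathcal X\to\{-1,0,1\}$ is $\mathsf R(h)=\Pr\{|\boldsymbol y-h(\boldsymbol x)|=2\}$. *The bounds.* For $\delta\in(0,1)$, $k\in\{0,\dots,N\}$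 and $\alpha<1$ let $$\tilde\Psi_{k,\delta}(\alpha)=\frac{\delta}{2N}\sum_{m=k}^{N-1}\frac{\binom mk}{\binom Nk}(1-\alpha)^{-(N-m)}+\frac{\delta}{6N}\sum_{m=N+1}^{4N}\frac{\binom mk}{\binom Nk}(1-\alpha)^{m-N}$$ (for $k=N$ the first sum is empty). For $k<N$ the equation $\tilde\Psi_{k,\delta}(\alpha)=1$ has exactly two solutions $\underline\alpha_k<\overline\alpha_k$ in $(-\infty,1)$; for $k=N$ it has exactly one, $\underline\alpha_N$. Set $\underline\epsilon_k=\max\{0,\underline\alpha_k\}$ for $k=0,\dots,N$, $\overline\epsilon_k=\overline\alpha_k$ for $k<N$, and $\overline\epsilon_N=1$. *Statement.* Assume that $\Pr\{\|\varphi(\boldsymbol x)-c\|^2=\gamma\}=0$ for all $c\in\mathcal H$ and $\gamma\in\mathbb R$. Then, for every $\delta\in(0,1)$, the event $\{\underline\epsilon_{\boldsymbol k}\le\mathsf R(\mathcal A_{\mathrm{GEM}}(\boldsymbol S))\le\overline\epsilon_{\boldsymbol k}\}$ is measurable up to a null set and $$\Pr\Big\{\underline\epsilon_{\boldsymbol k}\le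 \mathsf R\big(\mathcal A_{\mathrm{GEM}}(\boldsymbol S)\big)\le\overline\epsilon_{\boldsymbol k}\Big\}\ge 1-\delta,\qquad \boldsymbol k=|\mathsf c_{\mathrm{GEM}}(\boldsymbol S)|.$$ -/

import Mathlib

open MeasureTheory ProbabilityTheory
open scoped ENNReal

noncomputable section

/-! ### The bounds -/

/-- The function `Ψ̃_{k,δ}` for sample size `N`. For `k = N` the first sum is empty and
`N.choose N = 1`, so that only `δ / (6 N) * ∑ m.choose N * (1 - α) ^ (m - N)` is left. -/
def psiTilde (N : ℕ) (δ : ℝ) (k : ℕ) (α : ℝ) : ℝ :=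
  δ / (2 * N) * ∑ m ∈ Finset.Ico k N,
      ((m.choose k : ℝ) / (N.choose k : ℝ)) * ((1 - α) ^ (N - m))⁻¹
  + δ / (6 * N) * ∑ m ∈ Finset.Icc (N + 1) (4 * N),
      ((m.choose k : ℝ) / (N.choose k : ℝ)) * (1 - α) ^ (m - N)

/-- The solutions of `Ψ̃_{k,δ}(α) = 1` in `(-∞, 1)`: two for `k < N`, one for `k = N`
(when `1 ≤ N` and `0 < δ < 1`). -/
def psiTildeRoots (N : ℕ) (δ : ℝ) (k : ℕ) : Set ℝ :=
  {α : ℝ | α < 1 ∧ psiTilde N δ k α = 1}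

/-- The lower bound: the positive part of the smallest solution. -/
def epsLower (N : ℕ) (δ : ℝ) (k : ℕ) : ℝ :=
  max 0 (sInf (psiTildeRoots N δ k))

/-- The upper bound: the largest solution if `k < N`, and `1` if `k = N`. -/
def epsUpper (N : ℕ) (δ : ℝ) (k : ℕ) : ℝ :=
  if k < N then sSup (psiTildeRoots N δ k) else 1

/-! ### The Guaranteed Error Machine

An example is a pair `(x, y) : X × ℤˣ`; the group `ℤˣ` is the label set `{-1, 1}`. -/

section GEM

variable {X H : Type*} [NormedAddCommGroup H]

/-- The loss of a ternary classifier `h` (with values in `{-1, 0, 1}`) at an example: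
it is `1` exactly when the wrong label is issued, and abstention `h x = 0` costs nothing. -/
def gemLoss (h : X → ℤ) (z : X × ℤˣ) : ℕ :=
  if |(z.2 : ℤ) - h z.1| = 2 then 1 else 0

/-- The risk of a classifier, for examples with distribution `μ`. -/
def gemRisk [MeasurableSpace X] (μ : Measure (X × ℤˣ)) (h : X → ℤ) : ℝ :=
  μ.real {z | gemLoss h z = 1}

/-- The radius `r*`: the largest `r ∈ [0, ∞]` such that every example left in `P` whose label
differs from that of the center `c` has feature distance at least `r` from `c`. -/
def gemRadius (φ : X → H) (P : Multiset (X × ℤˣ)) (c : X × ℤˣ) : ℝ≥0∞ :=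
  sSup {r : ℝ≥0∞ | ∀ z ∈ P, z.2 ≠ c.2 → r ≤ ‖φ z.1 - φ c.1‖ₑ}

/-- The region formed around the center `c`: an open ball of radius `r*` in feature space. -/
def gemRegion (φ : X → H) (P : Multiset (X × ℤˣ)) (c : X × ℤˣ) : Set X :=
  {x | ‖φ x - φ c.1‖ₑ < gemRadius φ P c}

open Classical in
/-- The update of `P`: if `r* > 0` all examples in the region are removed,
if `r* = 0` the center (one copy of it) is removed. -/
def gemUpdate [LinearOrder X] (φ : X → H) (P : Multiset (X × ℤˣ)) (c : X × ℤˣ) :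
    Multiset (X × ℤˣ) :=
  if 0 < gemRadius φ P c then P.filter (fun z => z.1 ∉ gemRegion φ P c) else P.erase c

/-- `e` is admissible as the next center: a remaining example with a label different from that of
`c`, at feature distance `r*` from `c`, and with the smallest instance among all such examples. -/
def GemIsNext [LinearOrder X] (φ : X → H) (P : Multiset (X × ℤˣ)) (c e : X × ℤˣ) : Prop :=
  (e ∈ gemUpdate φ P c ∧ ‖φ e.1 - φ c.1‖ₑ = gemRadius φ P c ∧ e.2 ≠ c.2) ∧
    ∀ e' ∈ gemUpdate φ P c, ‖φ e'.1 - φ c.1‖ₑ = gemRadius φ P c → e'.2 ≠ c.2 → e.1 ≤ e'.1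

/-- If `r*` is finite, then the next center exists. -/
theorem gem_exists_next [LinearOrder X] (φ : X → H) (P : Multiset (X × ℤˣ)) (c : X × ℤˣ)
    (hr : gemRadius φ P c < ⊤) : ∃ e, GemIsNext φ P c e := by
  set r := gemRadius φ P c with hrdef
  have key : ∃ e ∈ P, e.2 ≠ c.2 ∧ ‖φ e.1 - φ c.1‖ₑ = r := by
    let Q : Finset (X × ℤˣ) := P.toFinset.filter (fun z => z.2 ≠ c.2)
    have hQ : Q.Nonempty := by
      by_contra hne
      rw [Finset.not_nonempty_iff_eq_empty] at hne
      have : (⊤ : ℝ≥0∞) ≤ r := by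
        refine le_sSup ?_
        intro z hz hzc
        have : z ∈ Q := by simp [Q, hz, hzc]
        simp [hne] at this
      exact absurd hr (not_lt.2 this)
    obtain ⟨e, heQ, he⟩ := Q.exists_min_image (fun z => ‖φ z.1 - φ c.1‖ₑ) hQ
    have heQ' : e ∈ P ∧ e.2 ≠ c.2 := by simpa [Q] using heQ
    refine ⟨e, heQ'.1, heQ'.2, le_antisymm ?_ ?_⟩
    · refine le_sSup ?_
      intro z hz hzc
      exact he z (by simp [Q, hz, hzc])
    · exact sSup_le fun s hs => hs e heQ'.1 heQ'.2
  obtain ⟨e, heP, hec, her⟩ := key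
  have heU : e ∈ gemUpdate φ P c := by
    unfold gemUpdate
    split_ifs with h0
    · classical
      refine Multiset.mem_filter.2 ⟨heP, ?_⟩
      simp [gemRegion, her, hrdef]
    · refine (Multiset.mem_erase_of_ne ?_).2 heP
      rintro rfl
      exact hec rfl
  let Q : Finset (X × ℤˣ) :=
    (gemUpdate φ P c).toFinset.filter (fun z => ‖φ z.1 - φ c.1‖ₑ = r ∧ z.2 ≠ c.2)
  obtain ⟨b, hbQ, hb⟩ := Q.exists_min_image (fun z => z.1) ⟨e, by simp [Q, heU, her, hec]⟩
  have hbQ' : b ∈ gemUpdate φ P c ∧ ‖φ b.1 - φ c.1‖ₑ = r ∧ b.2 ≠ c.2 := by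
    simpa [Q] using hbQ
  exact ⟨b, hbQ', fun e' h1 h2 h3 => hb e' (by simp [Q, h1, h3, ← hrdef, h2])⟩

open Classical in
/-- The main loop, started from the remaining examples `P` and the center `c` when `b` more
examples may still enter the compression (`b = d - |C|`). It returns the list of labelled regions
formed from then on, in order, and the multiset of examples added to `C` from then on.

For `b = 0` the algorithm has stopped because `|C| = d`. Otherwise a region is formed around `c`;
if `r* < ∞` the next center `e` is added to `C` and the loop goes on from `e` (in that case the
updated `P` contains `e` and is not empty); if `r* = ∞` the region is the whole space, the updated
`P` is empty and the algorithm stops. -/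
def gemLoop [LinearOrder X] (φ : X → H) :
    ℕ → Multiset (X × ℤˣ) → X × ℤˣ → List (Set X × ℤˣ) × Multiset (X × ℤˣ)
  | 0, _, _ => ([], 0)
  | b + 1, P, c =>
    if hr : gemRadius φ P c < ⊤ then
      let e := (gem_exists_next φ P c hr).choose
      let out := gemLoop φ b (gemUpdate φ P c) e
      ((gemRegion φ P c, c.2) :: out.1, e ::ₘ out.2)
    else
      ([(gemRegion φ P c, c.2)], 0)

/-- The output of GEM on the training set `S`, with maximal compression size `d` and initial
center `zbar` (which is added to the training set at the start). -/
def gemRun [LinearOrder X] (φ : X → H) (d : ℕ) (zbar : X × ℤˣ) (S : Multiset (X × ℤˣ)) :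
    List (Set X × ℤˣ) × Multiset (X × ℤˣ) :=
  gemLoop φ d (zbar ::ₘ S) zbar

open Classical in
/-- The label of the first region in the list that contains `x`, and `0` if there is none. -/
def firstLabel : List (Set X × ℤˣ) → X → ℤ
  | [], _ => 0
  | (R, y) :: L, x => if x ∈ R then (y : ℤ) else firstLabel L x

/-- The GEM predictor. -/
def gemPredictor [LinearOrder X] (φ : X → H) (d : ℕ) (zbar : X × ℤˣ) (S : Multiset (X × ℤˣ)) :
    X → ℤ :=
  firstLabel (gemRun φ d zbar S).1

/-- The GEM compression function. -/
def gemCompression [LinearOrder X] (φ : X → H) (d : ℕ) (zbar : X × ℤˣ)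
    (S : Multiset (X × ℤˣ)) : Multiset (X × ℤˣ) :=
  (gemRun φ d zbar S).2

/-- The training set: the multiset of the `N` observed examples. -/
def trainingSet {N : ℕ} {Z : Type*} (z : Fin N → Z) : Multiset Z :=
  Finset.univ.val.map z

/-- The risk of the GEM predictor trained on the examples `z 0, …, z (N - 1)` lies between the two
bounds evaluated at the size `k` of the compression. -/
def GemBoundsHold [MeasurableSpace X] [LinearOrder X] (φ : X → H) (d : ℕ) (zbar : X × ℤˣ)
    (μ : Measure (X × ℤˣ)) (δ : ℝ) {N : ℕ} (z : Fin N → X × ℤˣ) : Prop :=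
  epsLower N δ (gemCompression φ d zbar (trainingSet z)).card
      ≤ gemRisk μ (gemPredictor φ d zbar (trainingSet z)) ∧
    gemRisk μ (gemPredictor φ d zbar (trainingSet z))
      ≤ epsUpper N δ (gemCompression φ d zbar (trainingSet z)).card

end GEM

end

/-! Without ties, a run of GEM is encoded by the ordered list of centers chosen after the initial
one, and its risk is `1 - p`, where `p` (`compatProb`) is the probability that a new example is not
misclassified. For a sample of any size `m` and an injection `σ : Fin k ↪ Fin m`, the chosen
examples are those indexed by `σ` exactly when their list is valid and the other `m - k` examples
are compatible with it. By independence this has probability `∫ p ^ (m - k)` over valid lists,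
whatever `σ` is (`measure_selectionEvent_inter`). Compatibility with all examples determines the
list (`CentersValid.unique`), so these events are almost surely disjoint, and the sum over `k` of
`m.descFactorial k * ∫ p ^ (m - k)` is at most `1` for every `m`, not only for `m = N`.

Where the risk violates the bounds and `p > 0`, `psiTilde` is at least `1` at `1 - p`. Multiplied by
`N.descFactorial k * p ^ (N - k)`, this bounds the integrand of size `N` by those of the sizes `m <
N`, with weight `δ / (2N)`, and `N < m ≤ 4N`, with weight `δ / (6N)` (`descFactorial_mul_pow_le`;
the case `p = 0` is direct). Integrating over all valid lists and summing over `k` bounds the bad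
event by `N * δ / (2N) + 3N * δ / (6N) = δ`. -/

/-! ### The function `psiTilde` outside the interval between the bounds. -/

theorem psiTilde_continuousOn (N : ℕ) (δ : ℝ) (k : ℕ) :
    ContinuousOn (psiTilde N δ k) (Set.Iio 1) := by
  unfold psiTilde
  refine ContinuousOn.add (ContinuousOn.mul continuousOn_const (continuousOn_finsetSum _ ?_))
    (by fun_prop)
  intro m _
  refine continuousOn_const.mul (ContinuousOn.inv₀ (by fun_prop) ?_)
  intro α hα
  have : 0 < 1 - α := sub_pos.2 hα
  positivity

/-- The term `m = N + 1` alone is a positive multiple of `1 - β`, unbounded as `β → -∞`. -/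
theorem exists_lt_one_le_psiTilde {N : ℕ} (hN : 1 ≤ N) {δ : ℝ} (hδ : 0 < δ) {k : ℕ} (hk : k ≤ N)
    {α : ℝ} (hα : α < 1) : ∃ β < α, 1 ≤ psiTilde N δ k β := by
  have hC : (0 : ℝ) < N.choose k := by exact_mod_cast Nat.choose_pos hk
  have hC' : (0 : ℝ) < (N + 1).choose k := by exact_mod_cast Nat.choose_pos (by omega)
  have hNr : (0 : ℝ) < N := by exact_mod_cast hN
  set a : ℝ := δ / (6 * N) * (((N + 1).choose k : ℝ) / (N.choose k : ℝ)) with ha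
  have ha0 : 0 < a := by positivity
  have hle : ∀ β < 1, a * (1 - β) ≤ psiTilde N δ k β := by
    intro β hβ
    have hβ' : 0 < 1 - β := sub_pos.2 hβ
    unfold psiTilde
    have h1 : 0 ≤ δ / (2 * N) * ∑ m ∈ Finset.Ico k N,
      ((m.choose k : ℝ) / (N.choose k : ℝ)) * ((1 - β) ^ (N - m))⁻¹ := by positivity
    have h2 : (((N + 1).choose k : ℝ) / (N.choose k : ℝ)) * (1 - β) ^ (N + 1 - N) ≤
        ∑ m ∈ Finset.Icc (N + 1) (4 * N),
          ((m.choose k : ℝ) / (N.choose k : ℝ)) * (1 - β) ^ (m - N) :=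
      Finset.single_le_sum
        (f := fun m : ℕ => ((m.choose k : ℝ) / (N.choose k : ℝ)) * (1 - β) ^ (m - N))
        (fun m _ => by positivity) (Finset.mem_Icc.2 ⟨le_rfl, by omega⟩)
    have h3 := mul_le_mul_of_nonneg_left h2 (show 0 ≤ δ / (6 * N) by positivity)
    rw [Nat.add_sub_cancel_left, pow_one, ← mul_assoc] at h3
    linarith
  refine ⟨min (α - 1) (1 - 1 / a), by simp, ?_⟩
  have hβ : min (α - 1) (1 - 1 / a) < 1 := (min_le_left _ _).trans_lt (by linarith)
  refine le_trans ?_ (hle _ hβ)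
  have : 1 / a ≤ 1 - min (α - 1) (1 - 1 / a) := by linarith [min_le_right (α - 1) (1 - 1 / a)]
  calc 1 = a * (1 / a) := by field_simp
    _ ≤ _ := mul_le_mul_of_nonneg_left this ha0.le

/-- The term `m = N - 1`, present because `k < N`, is a positive multiple of `(1 - β)⁻¹` and blows
up at `1`. -/
theorem exists_gt_one_le_psiTilde {N : ℕ} {δ : ℝ} (hδ : 0 < δ) {k : ℕ} (hk : k < N)
    {α : ℝ} (hα : α < 1) : ∃ β, α < β ∧ β < 1 ∧ 1 ≤ psiTilde N δ k β := by
  have hC : (0 : ℝ) < N.choose k := by exact_mod_cast Nat.choose_pos hk.le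
  have hC' : (0 : ℝ) < (N - 1).choose k := by exact_mod_cast Nat.choose_pos (by omega)
  have hNr : (0 : ℝ) < N := by exact_mod_cast (by omega : 0 < N)
  set a : ℝ := δ / (2 * N) * (((N - 1).choose k : ℝ) / (N.choose k : ℝ)) with ha
  have ha0 : 0 < a := by positivity
  have hle : ∀ β < 1, a * (1 - β)⁻¹ ≤ psiTilde N δ k β := by
    intro β hβ
    have hβ' : 0 < 1 - β := sub_pos.2 hβ
    unfold psiTilde
    have h1 : 0 ≤ δ / (6 * N) * ∑ m ∈ Finset.Icc (N + 1) (4 * N),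
          ((m.choose k : ℝ) / (N.choose k : ℝ)) * (1 - β) ^ (m - N) := by positivity
    have h2 : (((N - 1).choose k : ℝ) / (N.choose k : ℝ)) * ((1 - β) ^ (N - (N - 1)))⁻¹ ≤
        ∑ m ∈ Finset.Ico k N,
          ((m.choose k : ℝ) / (N.choose k : ℝ)) * ((1 - β) ^ (N - m))⁻¹ :=
      Finset.single_le_sum
        (f := fun m : ℕ => ((m.choose k : ℝ) / (N.choose k : ℝ)) * ((1 - β) ^ (N - m))⁻¹)
        (fun m _ => by positivity) (Finset.mem_Ico.2 ⟨by omega, by omega⟩)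
    have h3 := mul_le_mul_of_nonneg_left h2 (show 0 ≤ δ / (2 * N) by positivity)
    rw [show N - (N - 1) = 1 by omega, pow_one, ← mul_assoc] at h3
    linarith
  have hβ : max ((1 + α) / 2) (1 - a) < 1 := max_lt (by linarith) (by linarith)
  refine ⟨max ((1 + α) / 2) (1 - a), lt_of_lt_of_le (by linarith) (le_max_left _ _), hβ, ?_⟩
  refine le_trans ?_ (hle _ hβ)
  have h0 : 0 < 1 - max ((1 + α) / 2) (1 - a) := sub_pos.2 hβ
  rw [← div_eq_mul_inv, one_le_div h0]
  linarith [le_max_right ((1 + α) / 2) (1 - a)]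

/-- The number of roots plays no role: a value below `1` at `α` and a value at least `1` further
left would enclose a root not above `α`. -/
theorem one_le_psiTilde_of_lt_epsLower {N : ℕ} (hN : 1 ≤ N) {δ : ℝ} (hδ : 0 < δ) {k : ℕ}
    (hk : k ≤ N) {α : ℝ} (hα0 : 0 ≤ α) (hα1 : α < 1) (hα : α < epsLower N δ k) :
    1 ≤ psiTilde N δ k α := by
  by_contra! hlt
  have hInf : α < sInf (psiTildeRoots N δ k) := by
    rcases lt_max_iff.1 hα with h | h
    · linarith
    · exact h
  obtain ⟨β, hβα, hβ⟩ := exists_lt_one_le_psiTilde hN hδ hk hα1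
  obtain ⟨r, hr, hr1⟩ := intermediate_value_Icc' hβα.le
    ((psiTilde_continuousOn N δ k).mono fun x hx => lt_of_le_of_lt hx.2 hα1) ⟨hlt.le, hβ⟩
  by_cases hbdd : BddBelow (psiTildeRoots N δ k)
  · have := csInf_le hbdd ⟨lt_of_le_of_lt hr.2 hα1, hr1⟩
    linarith [hr.2]
  -- An unbounded root set would give `sInf` the default value `0`, which `0 ≤ α` excludes.
  · rw [Real.sInf_of_not_bddBelow hbdd] at hInf
    linarith

theorem one_le_psiTilde_of_epsUpper_lt {N : ℕ} {δ : ℝ} (hδ : 0 < δ) {k : ℕ}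
    {α : ℝ} (hα1 : α < 1) (hα : epsUpper N δ k < α) :
    1 ≤ psiTilde N δ k α := by
  by_contra! hlt
  unfold epsUpper at hα
  split_ifs at hα with hkN
  · obtain ⟨β, hαβ, hβ1, hβ⟩ := exists_gt_one_le_psiTilde hδ hkN hα1
    obtain ⟨r, hr, hr1⟩ := intermediate_value_Icc hαβ.le
      ((psiTilde_continuousOn N δ k).mono fun x hx => lt_of_le_of_lt hx.2 hβ1) ⟨hlt.le, hβ⟩
    have hbdd : BddAbove (psiTildeRoots N δ k) := ⟨1, fun x hx => hx.1.le⟩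
    have := le_csSup hbdd ⟨lt_of_le_of_lt hr.2 hβ1, hr1⟩
    linarith [hr.1]
  · linarith

theorem epsLower_le_one (N : ℕ) (δ : ℝ) (k : ℕ) : epsLower N δ k ≤ 1 := by
  refine max_le zero_le_one ?_
  by_cases hbdd : BddBelow (psiTildeRoots N δ k)
  · rcases (psiTildeRoots N δ k).eq_empty_or_nonempty with h | ⟨r, hr⟩
    · simp [h]
    · exact (csInf_le hbdd hr).trans hr.1.le
  · simp [Real.sInf_of_not_bddBelow hbdd]

/-- Ratios of binomials are ratios of falling factorials, and falling factorials count the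
injections that index ordered lists of centers. -/
theorem descFactorial_mul_pow_le {N : ℕ} (hN : 1 ≤ N) {δ : ℝ} (hδ : 0 < δ) {k : ℕ}
    (hk : k ≤ N) {p : ℝ} (hp0 : 0 ≤ p) (hp1 : p ≤ 1)
    (hbad : ¬ (epsLower N δ k ≤ 1 - p ∧ 1 - p ≤ epsUpper N δ k)) :
    (N.descFactorial k : ℝ) * p ^ (N - k) ≤
      δ / (2 * N) * ∑ m ∈ Finset.range N, (m.descFactorial k : ℝ) * p ^ (m - k) +
      δ / (6 * N) * ∑ m ∈ Finset.Icc (N + 1) (4 * N), (m.descFactorial k : ℝ) * p ^ (m - k) := by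
  -- At `p = 0` the risk is `1`, outside the domain `α < 1`: for `k = N` the bounds hold there, and
  -- for `k < N` the left side vanishes.
  rcases hp0.eq_or_lt with rfl | hp
  · rcases hk.eq_or_lt with rfl | hkN
    · refine absurd ⟨?_, ?_⟩ hbad
      · simpa using epsLower_le_one k δ k
      · simp [epsUpper]
    · rw [zero_pow (by omega), mul_zero]
      positivity
  · have hpsi : 1 ≤ psiTilde N δ k (1 - p) := by
      rcases not_and_or.1 hbad with h | h
      · exact one_le_psiTilde_of_lt_epsLower hN hδ hk (by linarith) (by linarith) (not_le.1 h)
      · exact one_le_psiTilde_of_epsUpper_lt hδ (by linarith) (not_le.1 h)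
    have hD : (0 : ℝ) < N.descFactorial k := by
      have : N.descFactorial k ≠ 0 := fun h => by
        rw [Nat.descFactorial_eq_zero_iff_lt] at h; omega
      exact_mod_cast Nat.pos_of_ne_zero this
    have hratio : ∀ m : ℕ, (m.choose k : ℝ) / (N.choose k : ℝ) =
        (m.descFactorial k : ℝ) / (N.descFactorial k : ℝ) := by
      intro m
      rw [Nat.descFactorial_eq_factorial_mul_choose, Nat.descFactorial_eq_factorial_mul_choose]
      push_cast
      rw [mul_div_mul_left]
      exact Nat.cast_ne_zero.2 (Nat.factorial_ne_zero k)
    have hmul := mul_le_mul_of_nonneg_left hpsi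
      (show 0 ≤ (N.descFactorial k : ℝ) * p ^ (N - k) by positivity)
    rw [mul_one] at hmul
    refine hmul.trans ?_
    unfold psiTilde
    rw [mul_add, mul_left_comm, mul_left_comm _ (δ / (6 * N)),
      Finset.mul_sum _ _ ((N.descFactorial k : ℝ) * p ^ (N - k)),
      Finset.mul_sum _ _ ((N.descFactorial k : ℝ) * p ^ (N - k))]
    simp only [hratio, sub_sub_cancel]
    refine add_le_add
      (mul_le_mul_of_nonneg_left ?_ (show 0 ≤ δ / (2 * N) by positivity))
      (mul_le_mul_of_nonneg_left ?_ (show 0 ≤ δ / (6 * N) by positivity))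
    -- Passing from `Ico k N` to `range N` only adds terms with `m < k`, whose falling factorial is
    -- `0`.
    · refine le_trans (le_of_eq (Finset.sum_congr rfl fun m hm => ?_))
        (Finset.sum_le_sum_of_subset_of_nonneg
          (f := fun m : ℕ => (m.descFactorial k : ℝ) * p ^ (m - k))
          (fun m hm => Finset.mem_range.2 (Finset.mem_Ico.1 hm).2) fun m _ _ => by positivity)
      obtain ⟨h1, h2⟩ := Finset.mem_Ico.1 hm
      rw [show N - k = (m - k) + (N - m) by omega, pow_add]
      field_simp
    · refine le_of_eq (Finset.sum_congr rfl fun m hm => ?_)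
      obtain ⟨h1, h2⟩ := Finset.mem_Icc.1 hm
      rw [show m - k = (N - k) + (m - N) by omega, pow_add]
      field_simp

/-! ### Runs of the algorithm as lists of centers. -/

section CenterSequences

variable {X H : Type*} [NormedAddCommGroup H]

/-- `z` is not misclassified by the predictor with successive centers `c :: L`, when at most `b`
regions are formed. -/
def CentersCompat (φ : X → H) : ℕ → X × ℤˣ → List (X × ℤˣ) → X × ℤˣ → Prop
  | 0, _, _, _ => True
  | _ + 1, c, [], z => z.2 = c.2
  | b + 1, c, e :: L, z =>
    (‖φ z.1 - φ c.1‖ < ‖φ e.1 - φ c.1‖ → z.2 = c.2) ∧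
      (‖φ e.1 - φ c.1‖ ≤ ‖φ z.1 - φ c.1‖ → CentersCompat φ b e L z)

open Classical in
/-- The prediction at `x` with successive centers `c :: L`, when at most `b` regions are formed. -/
noncomputable def centersLabel (φ : X → H) : ℕ → X × ℤˣ → List (X × ℤˣ) → X → ℤ
  | 0, _, _, _ => 0
  | _ + 1, c, [], _ => c.2
  | b + 1, c, e :: L, x =>
    if ‖φ x - φ c.1‖ < ‖φ e.1 - φ c.1‖ then c.2 else centersLabel φ b e L x

/-- `L` may be the list of centers that follow `c` in a run of the algorithm in which at most `b`
examples enter the compression. -/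
def CentersValid (φ : X → H) : ℕ → X × ℤˣ → List (X × ℤˣ) → Prop
  | _, _, [] => True
  | 0, _, _ :: _ => False
  | b + 1, c, e :: L =>
    e.2 ≠ c.2 ∧ 0 < ‖φ e.1 - φ c.1‖ ∧ (∀ w ∈ L, ‖φ e.1 - φ c.1‖ ≤ ‖φ w.1 - φ c.1‖) ∧
      CentersValid φ b e L

/-- No two examples of `P` have the same feature distance from an example of `P`. -/
def NoTies (φ : X → H) (P : Set (X × ℤˣ)) : Prop :=
  ∀ c ∈ P, Set.InjOn (fun z : X × ℤˣ => ‖φ z.1 - φ c.1‖) P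

variable {φ : X → H}

theorem NoTies.mono {P Q : Set (X × ℤˣ)} (hP : NoTies φ P) (h : Q ⊆ P) : NoTies φ Q :=
  fun c hc => (hP c (h hc)).mono h

theorem NoTies.norm_pos {P : Set (X × ℤˣ)} (hP : NoTies φ P) {e c : X × ℤˣ} (he : e ∈ P)
    (hc : c ∈ P) (hne : e ≠ c) : 0 < ‖φ e.1 - φ c.1‖ := by
  refine lt_of_le_of_ne (norm_nonneg _) fun h => hne (hP c hc he hc ?_)
  simp [← h]

theorem CentersValid.compat_center {b : ℕ} {c : X × ℤˣ} {L : List (X × ℤˣ)}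
    (h : CentersValid φ b c L) : CentersCompat φ b c L c := by
  match b, L with
  | 0, _ => trivial
  | b + 1, [] => rfl
  | b + 1, e :: L =>
    refine ⟨fun _ => rfl, fun hle => absurd h.2.1 ?_⟩
    simpa using hle

/-- Selected examples are never misclassified: each lies outside the earlier balls, and inside its
own ball if one is formed. Hence `selectionEvent` needs to constrain only the unselected examples.
-/
theorem CentersValid.compat_mem {b : ℕ} {c : X × ℤˣ} {L : List (X × ℤˣ)}
    (h : CentersValid φ b c L) {w : X × ℤˣ} (hw : w ∈ L) : CentersCompat φ b c L w := by
  induction b generalizing c L with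
  | zero => trivial
  | succ b ih =>
    match L with
    | [] => simp at hw
    | e :: L =>
      obtain ⟨-, -, h3, h4⟩ := h
      rcases List.mem_cons.1 hw with rfl | hw'
      · exact ⟨fun hlt => absurd hlt (lt_irrefl _), fun _ => h4.compat_center⟩
      · exact ⟨fun hlt => absurd (h3 w hw') (not_le.2 hlt), fun _ => ih h4 hw'⟩

/-- The list of centers is determined by the examples. -/
theorem CentersValid.unique {b : ℕ} {c : X × ℤˣ} {L L' : List (X × ℤˣ)} {P : Set (X × ℤˣ)}
    (hP : NoTies φ P) (hc : c ∈ P) (h : CentersValid φ b c L) (h' : CentersValid φ b c L')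
    (hL : ∀ w ∈ L, w ∈ P) (hL' : ∀ w ∈ L', w ∈ P)
    (hcompat : ∀ z ∈ P, CentersCompat φ b c L z) (hcompat' : ∀ z ∈ P, CentersCompat φ b c L' z) :
    L = L' := by
  induction b generalizing c L L' P with
  | zero =>
    match L, L' with
    | [], [] => rfl
    | _ :: _, _ => exact h.elim
    | [], _ :: _ => exact h'.elim
  | succ b ih =>
    match L, L' with
    | [], [] => rfl
    | [], e :: _ => exact absurd (hcompat e (hL' e (by simp))) h'.1
    | e :: _, [] => exact absurd (hcompat' e (hL e (by simp))) h.1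
    | e :: L, e' :: L' =>
      obtain ⟨h1, -, h3, h4⟩ := h
      obtain ⟨h1', -, h3', h4'⟩ := h'
      have heP := hL e (by simp)
      have heP' := hL' e' (by simp)
      -- If the distances from `c` differed, the nearer candidate would lie in the other run's ball
      -- with a label other than that of `c`.
      have hee : e = e' := by
        rcases lt_trichotomy ‖φ e.1 - φ c.1‖ ‖φ e'.1 - φ c.1‖ with hlt | heq | hlt
        · exact absurd ((hcompat' e heP).1 hlt) h1
        · exact hP c hc heP heP' heq
        · exact absurd ((hcompat e' heP').1 hlt) h1'
      subst hee
      congr 1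
      -- The later centers are tested only against the examples outside the first ball.
      refine ih (P := {z ∈ P | ‖φ e.1 - φ c.1‖ ≤ ‖φ z.1 - φ c.1‖}) (hP.mono fun _ hz => hz.1)
        ⟨heP, le_rfl⟩ h4 h4' (fun w hw => ⟨hL w (by simp [hw]), h3 w hw⟩)
        (fun w hw => ⟨hL' w (by simp [hw]), h3' w hw⟩)
        (fun z hz => (hcompat z hz.1).2 hz.2) (fun z hz => (hcompat' z hz.1).2 hz.2)

theorem abs_intUnit_sub_eq_two_iff (y y' : ℤˣ) : |(y : ℤ) - (y' : ℤ)| = 2 ↔ y ≠ y' := by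
  rcases Int.units_eq_one_or y with rfl | rfl <;> rcases Int.units_eq_one_or y' with rfl | rfl <;>
    decide

theorem gemLoss_centersLabel (b : ℕ) (c : X × ℤˣ) (L : List (X × ℤˣ)) (z : X × ℤˣ) :
    gemLoss (centersLabel φ b c L) z = 1 ↔ ¬ CentersCompat φ b c L z := by
  have key : |(z.2 : ℤ) - centersLabel φ b c L z.1| = 2 ↔ ¬ CentersCompat φ b c L z := by
    induction b generalizing c L with
    | zero =>
      rcases Int.units_eq_one_or z.2 with h | h <;> simp [centersLabel, CentersCompat, h]
    | succ b ih =>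
      match L with
      | [] => simpa [centersLabel, CentersCompat] using abs_intUnit_sub_eq_two_iff z.2 c.2
      | e :: L =>
        by_cases hlt : ‖φ z.1 - φ c.1‖ < ‖φ e.1 - φ c.1‖
        · simpa [centersLabel, CentersCompat, hlt, not_le.2 hlt] using
            abs_intUnit_sub_eq_two_iff z.2 c.2
        · simpa [centersLabel, CentersCompat, hlt, not_lt.1 hlt] using ih e L
  unfold gemLoss
  split_ifs with h
  · simpa using key.1 h
  · simpa using fun h' => h (key.2 h')

theorem gemRadius_le {P : Multiset (X × ℤˣ)} {c z : X × ℤˣ} (hz : z ∈ P) (hzc : z.2 ≠ c.2) :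
    gemRadius φ P c ≤ ‖φ z.1 - φ c.1‖ₑ :=
  sSup_le fun _ hs => hs z hz hzc

/-- In the absence of ties, the algorithm outputs a valid list of centers that is compatible with
all examples. -/
theorem gemLoop_exists_centers [LinearOrder X] (b : ℕ) (P : Multiset (X × ℤˣ)) (c : X × ℤˣ)
    (hnd : P.Nodup) (hP : NoTies φ {z | z ∈ P}) (hc : c ∈ P) :
    ∃ L : List (X × ℤˣ), (L : Multiset (X × ℤˣ)) ≤ P.erase c ∧ (gemLoop φ b P c).2 = L ∧
      firstLabel (gemLoop φ b P c).1 = centersLabel φ b c L ∧ CentersValid φ b c L ∧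
      ∀ z ∈ P, CentersCompat φ b c L z := by
  classical
  induction b generalizing P c with
  | zero => exact ⟨[], by simp, by simp [gemLoop], by ext; simp [gemLoop, firstLabel, centersLabel],
      trivial, fun _ _ => trivial⟩
  | succ b ih =>
    by_cases hr : gemRadius φ P c < ⊤
    · have hloop : gemLoop φ (b + 1) P c =
          ((gemRegion φ P c, c.2) ::
            (gemLoop φ b (gemUpdate φ P c) (gem_exists_next φ P c hr).choose).1,
            (gem_exists_next φ P c hr).choose ::ₘ
              (gemLoop φ b (gemUpdate φ P c) (gem_exists_next φ P c hr).choose).2) := by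
        rw [gemLoop, dif_pos hr]
      obtain ⟨⟨heU, her, hec⟩, -⟩ := (gem_exists_next φ P c hr).choose_spec
      set e := (gem_exists_next φ P c hr).choose
      have hreg : ∀ x, x ∈ gemRegion φ P c ↔ ‖φ x - φ c.1‖ < ‖φ e.1 - φ c.1‖ := by
        intro x
        change ‖φ x - φ c.1‖ₑ < gemRadius φ P c ↔ _
        rw [← her, lt_iff_lt_of_le_iff_le enorm_le_iff_norm_le]
      have hne : e ≠ c := fun h => hec (by rw [h])
      have hUP : ∀ w ∈ gemUpdate φ P c, w ∈ P := by
        intro w hw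
        unfold gemUpdate at hw
        split_ifs at hw
        · exact (Multiset.mem_filter.1 hw).1
        · exact Multiset.mem_of_mem_erase hw
      -- Absence of ties forces `r* > 0`, so the update is always the filter, and it discards `c`,
      -- which lies in its own ball.
      have hpos : 0 < ‖φ e.1 - φ c.1‖ := hP.norm_pos (hUP e heU) hc hne
      have hr0 : 0 < gemRadius φ P c := by
        rw [← her]
        exact enorm_pos.2 (norm_pos_iff.1 hpos)
      have hU : gemUpdate φ P c = P.filter (fun z => z.1 ∉ gemRegion φ P c) := if_pos hr0
      have hmem : ∀ w, w ∈ gemUpdate φ P c ↔ w ∈ P ∧ ‖φ e.1 - φ c.1‖ ≤ ‖φ w.1 - φ c.1‖ := by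
        intro w
        rw [hU, Multiset.mem_filter, hreg, not_lt]
      have hndU : (gemUpdate φ P c).Nodup := by rw [hU]; exact hnd.filter _
      obtain ⟨L, hL1, hL2, hL3, hL4, hL5⟩ := ih _ e hndU (hP.mono hUP) heU
      refine ⟨e :: L, ?_, ?_, ?_, ⟨hec, hpos, ?_, hL4⟩, ?_⟩
      · rw [← Multiset.cons_coe]
        calc e ::ₘ (L : Multiset (X × ℤˣ)) ≤ e ::ₘ (gemUpdate φ P c).erase e :=
              Multiset.cons_le_cons _ hL1
          _ = gemUpdate φ P c := Multiset.cons_erase heU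
          _ ≤ P.erase c := by
              refine (Multiset.le_iff_subset hndU).2 fun w hw => ?_
              refine (Multiset.mem_erase_of_ne ?_).2 (hUP w hw)
              rintro rfl
              have := ((hmem w).1 hw).2
              simp only [sub_self, norm_zero] at this
              exact absurd hpos (not_lt.2 this)
      · rw [hloop, hL2, Multiset.cons_coe]
      · ext x
        rw [hloop]
        simp only [firstLabel, centersLabel, hreg, hL3]
      · exact fun w hw => ((hmem w).1 (Multiset.mem_of_mem_erase
          (Multiset.mem_of_le hL1 (by simpa using hw)))).2
      · intro z hz
        refine ⟨fun hlt => ?_, fun hle => hL5 z ((hmem z).2 ⟨hz, hle⟩)⟩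
        by_contra hzc
        have := gemRadius_le (φ := φ) hz hzc
        rw [← her, enorm_le_iff_norm_le] at this
        exact absurd hlt (not_lt.2 this)
    · have htop : gemRadius φ P c = ⊤ := not_lt_top_iff.1 hr
      have hloop : gemLoop φ (b + 1) P c = ([(gemRegion φ P c, c.2)], 0) := by
        rw [gemLoop, dif_neg hr]
      refine ⟨[], by simp, by simp [hloop], ?_, trivial, ?_⟩
      · ext x
        rw [hloop]
        simp [firstLabel, centersLabel, gemRegion, htop]
      · intro z hz
        by_contra hzc
        have := gemRadius_le (φ := φ) hz hzc
        rw [htop, top_le_iff] at this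
        exact enorm_ne_top this

end CenterSequences

/-! ### Measurability, almost sure absence of ties, and probabilities of selections. -/

section CenterProbabilities

variable {X H : Type*} [MeasurableSpace X] [NormedAddCommGroup H] {φ : X → H}

theorem measurable_dist_comp (hφ : Measurable (fun p : X × X => ‖φ p.1 - φ p.2‖))
    {A : Type*} [MeasurableSpace A] {f g : A → X × ℤˣ} (hf : Measurable f) (hg : Measurable g) :
    Measurable fun a => ‖φ (f a).1 - φ (g a).1‖ :=
  hφ.comp (hf.fst.prodMk hg.fst)

theorem measurableSet_label_eq {A : Type*} [MeasurableSpace A] {f g : A → X × ℤˣ}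
    (hf : Measurable f) (hg : Measurable g) : MeasurableSet {a | (f a).2 = (g a).2} := by
  have hval : Measurable ((↑) : ℤˣ → ℤ) := comap_measurable _
  have := measurableSet_eq_fun (hval.comp hf.snd) (hval.comp hg.snd)
  simpa [Units.val_inj] using this

theorem measurableSet_centersCompat (hφ : Measurable (fun p : X × X => ‖φ p.1 - φ p.2‖))
    {A : Type*} [MeasurableSpace A] (b : ℕ) {c z : A → X × ℤˣ} (hc : Measurable c)
    (hz : Measurable z) {k : ℕ} {v : Fin k → A → X × ℤˣ} (hv : ∀ i, Measurable (v i)) :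
    MeasurableSet {a | CentersCompat φ b (c a) (List.ofFn fun i => v i a) (z a)} := by
  induction k generalizing b c with
  | zero =>
    cases b with
    | zero => simp [CentersCompat]
    | succ b => simpa [CentersCompat] using measurableSet_label_eq hz hc
  | succ k ih =>
    cases b with
    | zero => simp [CentersCompat]
    | succ b =>
      simp only [List.ofFn_succ, CentersCompat, imp_iff_not_or]
      have h1 := measurable_dist_comp hφ hz hc
      have h2 := measurable_dist_comp hφ (hv 0) hc
      exact (((measurableSet_lt h1 h2).compl.union (measurableSet_label_eq hz hc)).inter
        ((measurableSet_le h2 h1).compl.union (ih b (hv 0) fun i => hv i.succ)))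

theorem measurableSet_centersValid (hφ : Measurable (fun p : X × X => ‖φ p.1 - φ p.2‖))
    {A : Type*} [MeasurableSpace A] (b : ℕ) {c : A → X × ℤˣ} (hc : Measurable c)
    {k : ℕ} {v : Fin k → A → X × ℤˣ} (hv : ∀ i, Measurable (v i)) :
    MeasurableSet {a | CentersValid φ b (c a) (List.ofFn fun i => v i a)} := by
  induction k generalizing b c with
  | zero => simp [CentersValid]
  | succ k ih =>
    cases b with
    | zero => simp [CentersValid]
    | succ b =>
      simp only [List.ofFn_succ, CentersValid, List.forall_mem_ofFn_iff]
      have h2 := measurable_dist_comp hφ (hv 0) hc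
      refine (measurableSet_label_eq (hv 0) hc).compl.inter
        ((measurableSet_lt measurable_const h2).inter (MeasurableSet.inter ?_
          (ih b (hv 0) fun i => hv i.succ)))
      have : {a | ∀ i : Fin k, ‖φ (v 0 a).1 - φ (c a).1‖ ≤ ‖φ (v i.succ a).1 - φ (c a).1‖} =
          ⋂ i : Fin k, {a | ‖φ (v 0 a).1 - φ (c a).1‖ ≤ ‖φ (v i.succ a).1 - φ (c a).1‖} := by
        ext; simp
      exact (congrArg MeasurableSet this).mpr <| MeasurableSet.iInter fun i =>
        measurableSet_le h2 (measurable_dist_comp hφ (hv i.succ) hc)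

/-- A measurable set of a product space is null if its sections along one coordinate are null. -/
theorem pi_measure_eq_zero_of_sections {Z : Type*} [MeasurableSpace Z] {n : ℕ} (μ : Measure Z)
    [SigmaFinite μ] (i : Fin n) {s : Set (Fin n → Z)} (hs : MeasurableSet s)
    (h : ∀ w, μ {x | Function.update w i x ∈ s} = 0) : Measure.pi (fun _ : Fin n => μ) s = 0 := by
  match n with
  | 0 => exact i.elim0
  | n + 1 =>
    have hmp := (measurePreserving_piFinSuccAbove (fun _ : Fin (n + 1) => μ) i).symm
    rw [← hmp.measure_preimage hs.nullMeasurableSet,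
      Measure.prod_apply_symm (hmp.measurable hs), lintegral_eq_zero_iff']
    · refine Filter.Eventually.of_forall fun u => ?_
      rcases isEmpty_or_nonempty Z with hZ | ⟨⟨x₀⟩⟩
      · simp [Measure.eq_zero_of_isEmpty μ]
      · refine Eq.trans (congrArg μ ?_) (h (i.insertNth x₀ u))
        ext x
        simp [MeasurableEquiv.piFinSuccAbove, Fin.insertNthEquiv]
    · exact (measurable_measure_prodMk_right (hmp.measurable hs)).aemeasurable

/-- The sample together with the additional example. -/
def withInitial {Z : Type*} {n : ℕ} (c : Z) (w : Fin n → Z) : Option (Fin n) → Z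
  | none => c
  | some i => w i

/-- With all coordinates but `i` frozen, a tie puts the feature of example `i` on a fixed sphere,
which is null by assumption. -/
theorem ae_dist_ne (hφ : Measurable (fun p : X × X => ‖φ p.1 - φ p.2‖)) (μ : Measure (X × ℤˣ))
    [IsProbabilityMeasure μ]
    (hsphere : ∀ (c : H) (γ : ℝ), μ {w | ‖φ w.1 - c‖ ^ 2 = γ} = 0) (c : X × ℤˣ) {n : ℕ}
    (i : Fin n) (j l : Option (Fin n)) (hl : l ≠ some i) :
    ∀ᵐ w ∂Measure.pi (fun _ : Fin n => μ),
      ‖φ (withInitial c w (some i)).1 - φ (withInitial c w j).1‖ ≠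
        ‖φ (withInitial c w l).1 - φ (withInitial c w j).1‖ := by
  have hm : ∀ o, Measurable fun w : Fin n → X × ℤˣ => withInitial c w o := by
    rintro (_ | i)
    · exact measurable_const
    · exact measurable_pi_apply i
  have hup : ∀ w x, ∀ o, o ≠ some i →
      withInitial c (Function.update w i x) o = withInitial c w o := by
    rintro w x (_ | o) ho
    · rfl
    · exact Function.update_of_ne (fun h => ho (congrArg some h)) _ _
  have hup' : ∀ w x, withInitial c (Function.update w i x) (some i) = x :=
    fun w x => Function.update_self _ _ _
  rw [ae_iff]
  simp only [ne_eq, not_not]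
  refine pi_measure_eq_zero_of_sections μ i
    (measurableSet_eq_fun (measurable_dist_comp hφ (hm _) (hm _))
      (measurable_dist_comp hφ (hm _) (hm _))) fun w => ?_
  simp only [Set.mem_ofPred_eq, hup', hup w _ l hl]
  -- If example `i` is itself the reference point, the tie says that its distance from example `l`
  -- is `0`: a sphere of radius `0`.
  by_cases hj : j = some i
  · subst hj
    refine measure_mono_null (fun x hx => ?_) (hsphere (φ (withInitial c w l).1) 0)
    simp only [Set.mem_ofPred_eq, hup', sub_self, norm_zero] at hx
    rw [Set.mem_ofPred_eq, norm_sub_rev, ← hx]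
    simp
  · refine measure_mono_null (fun x hx => ?_) (hsphere (φ (withInitial c w j).1)
      (‖φ (withInitial c w l).1 - φ (withInitial c w j).1‖ ^ 2))
    simp only [Set.mem_ofPred_eq, hup w _ j hj] at hx
    rw [Set.mem_ofPred_eq, hx]

/-- Almost surely, the sample and the additional example are distinct and have no ties. -/
theorem ae_injective_noTies (hφ : Measurable (fun p : X × X => ‖φ p.1 - φ p.2‖))
    (μ : Measure (X × ℤˣ)) [IsProbabilityMeasure μ]
    (hsphere : ∀ (c : H) (γ : ℝ), μ {w | ‖φ w.1 - c‖ ^ 2 = γ} = 0) (c : X × ℤˣ) (n : ℕ) :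
    ∀ᵐ w ∂Measure.pi (fun _ : Fin n => μ),
      Function.Injective (withInitial c w) ∧ NoTies φ (Set.range (withInitial c w)) := by
  have h : ∀ᵐ w ∂Measure.pi (fun _ : Fin n => μ), ∀ i : Fin n, ∀ j l : Option (Fin n),
      l ≠ some i → ‖φ (withInitial c w (some i)).1 - φ (withInitial c w j).1‖ ≠
        ‖φ (withInitial c w l).1 - φ (withInitial c w j).1‖ := by
    rw [ae_all_iff]; intro i
    rw [ae_all_iff]; intro j
    rw [ae_all_iff]; intro l
    by_cases hl : l = some i
    · simp [hl]
    · simpa [hl] using ae_dist_ne hφ μ hsphere c i j l hl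
  filter_upwards [h] with w hw
  have key : ∀ o j l : Option (Fin n), ‖φ (withInitial c w o).1 - φ (withInitial c w j).1‖ =
      ‖φ (withInitial c w l).1 - φ (withInitial c w j).1‖ → o = l := by
    intro o j l heq
    by_contra hne
    match o, l with
    | none, none => exact hne rfl
    | some i, l => exact hw i j l (fun h => hne h.symm) heq
    | none, some i => exact hw i j none (by simp) heq.symm
  refine ⟨fun o l hol => key o o l (by rw [hol]), ?_⟩
  rintro _ ⟨j, rfl⟩ _ ⟨o, rfl⟩ _ ⟨l, rfl⟩ heq
  rw [key o j l heq]

/-- The centers selected from the sample `w` after `c` are those with indices `σ 0, σ 1, …`. -/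
def selectionEvent (φ : X → H) (d : ℕ) (c : X × ℤˣ) {k m : ℕ} (σ : Fin k ↪ Fin m) :
    Set (Fin m → X × ℤˣ) :=
  {w | CentersValid φ d c (List.ofFn fun i => w (σ i)) ∧
    ∀ j ∉ Set.range σ, CentersCompat φ d c (List.ofFn fun i => w (σ i)) (w j)}

theorem measurableSet_selectionEvent (hφ : Measurable (fun p : X × X => ‖φ p.1 - φ p.2‖))
    (d : ℕ) (c : X × ℤˣ) {k m : ℕ} (σ : Fin k ↪ Fin m) :
    MeasurableSet (selectionEvent φ d c σ) := by
  have hv : ∀ i : Fin k, Measurable fun w : Fin m → X × ℤˣ => w (σ i) :=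
    fun i => measurable_pi_apply _
  refine (measurableSet_centersValid hφ d measurable_const hv).inter ?_
  have : {w : Fin m → X × ℤˣ | ∀ j ∉ Set.range σ,
      CentersCompat φ d c (List.ofFn fun i => w (σ i)) (w j)} = ⋂ j, ⋂ _ : j ∉ Set.range σ,
        {w | CentersCompat φ d c (List.ofFn fun i => w (σ i)) (w j)} := by
    ext; simp
  exact (congrArg MeasurableSet this).mpr <| MeasurableSet.iInter fun j => MeasurableSet.iInter fun _ =>
    measurableSet_centersCompat hφ d measurable_const (measurable_pi_apply j) hv

/-- The probability that a random example is not misclassified. -/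
noncomputable def compatProb (φ : X → H) (d : ℕ) (c : X × ℤˣ) (μ : Measure (X × ℤˣ))
    (L : List (X × ℤˣ)) : ℝ≥0∞ :=
  μ {z | CentersCompat φ d c L z}

theorem measurable_compatProb (hφ : Measurable (fun p : X × X => ‖φ p.1 - φ p.2‖))
    (d : ℕ) (c : X × ℤˣ) (μ : Measure (X × ℤˣ)) [IsProbabilityMeasure μ] (k : ℕ) :
    Measurable fun v : Fin k → X × ℤˣ => compatProb φ d c μ (List.ofFn v) :=
  measurable_measure_prodMk_left (measurableSet_centersCompat hφ d
    (A := (Fin k → X × ℤˣ) × (X × ℤˣ)) measurable_const measurable_snd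
    fun i => (measurable_pi_apply i).comp measurable_fst)

/-- Splitting a sample into the coordinates in the range of `σ` and the other coordinates. -/
theorem exists_equiv_sum_of_embedding {k m : ℕ} (σ : Fin k ↪ Fin m) :
    ∃ e : Fin k ⊕ Fin (m - k) ≃ Fin m, (∀ i, e (Sum.inl i) = σ i) ∧
      ∀ j, j ∉ Set.range σ ↔ ∃ i, e (Sum.inr i) = j := by
  classical
  have hcard : Fintype.card {j // j ∉ Set.range σ} = m - k := by
    rw [Fintype.card_subtype_compl, Fintype.card_fin]
    congr 1
    exact (Set.card_range_of_injective σ.injective).trans (Fintype.card_fin k)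
  let f := (Fintype.equivFinOfCardEq hcard).symm
  refine ⟨(Equiv.sumCongr (Equiv.ofInjective σ σ.injective) f).trans
    (Equiv.sumCompl (· ∈ Set.range σ)), fun i => by simp, fun j => ⟨fun hj => ?_, ?_⟩⟩
  · exact ⟨f.symm ⟨j, hj⟩, by simp⟩
  · rintro ⟨i, rfl⟩
    simpa using (f i).2

/-- Given the `k` selected examples, the `m - k` others are independent and each is compatible with
probability `compatProb`. The value does not depend on `σ`, so summing over `σ` only produces a
falling factorial. -/
theorem measure_selectionEvent_inter (hφ : Measurable (fun p : X × X => ‖φ p.1 - φ p.2‖))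
    (d : ℕ) (c : X × ℤˣ) (μ : Measure (X × ℤˣ)) [IsProbabilityMeasure μ] {k m : ℕ}
    (σ : Fin k ↪ Fin m) {B : Set (Fin k → X × ℤˣ)} (hB : MeasurableSet B) :
    Measure.pi (fun _ : Fin m => μ) (selectionEvent φ d c σ ∩ {w | (fun i => w (σ i)) ∈ B}) =
      ∫⁻ v in {v | CentersValid φ d c (List.ofFn v)} ∩ B,
        compatProb φ d c μ (List.ofFn v) ^ (m - k) ∂Measure.pi (fun _ : Fin k => μ) := by
  obtain ⟨e, he1, he2⟩ := exists_equiv_sum_of_embedding σ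
  have hmp : MeasurePreserving _ ((Measure.pi fun _ : Fin k => μ).prod
      (Measure.pi fun _ : Fin (m - k) => μ)) (Measure.pi fun _ : Fin m => μ) :=
    (measurePreserving_piCongrLeft (fun _ : Fin m => μ) e).comp
      (measurePreserving_sumPiEquivProdPi (fun _ : Fin k ⊕ Fin (m - k) => μ)).symm
  have hσ : ∀ i : Fin k, Measurable fun w : Fin m → X × ℤˣ => w (σ i) :=
    fun i => measurable_pi_apply _
  have hs : MeasurableSet (selectionEvent φ d c σ ∩ {w | (fun i => w (σ i)) ∈ B}) :=
    (measurableSet_selectionEvent hφ d c σ).inter (measurable_pi_lambda _ hσ hB)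
  have hV : MeasurableSet ({v : Fin k → X × ℤˣ | CentersValid φ d c (List.ofFn v)} ∩ B) :=
    (measurableSet_centersValid hφ d measurable_const measurable_pi_apply).inter hB
  rw [← hmp.measure_preimage hs.nullMeasurableSet, Measure.prod_apply (hmp.measurable hs),
    ← lintegral_indicator hV]
  refine lintegral_congr fun v => ?_
  have hl : ∀ u : Fin (m - k) → X × ℤˣ, ∀ i, MeasurableEquiv.piCongrLeft (fun _ : Fin m => X × ℤˣ) e
      ((MeasurableEquiv.sumPiEquivProdPi fun _ : Fin k ⊕ Fin (m - k) => X × ℤˣ).symm (v, u))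
        (σ i) = v i := by
    intro u i
    rw [← he1 i, MeasurableEquiv.coe_piCongrLeft, Equiv.piCongrLeft_apply_apply]
    rfl
  have hrr : ∀ u : Fin (m - k) → X × ℤˣ, ∀ i, MeasurableEquiv.piCongrLeft
      (fun _ : Fin m => X × ℤˣ) e
      ((MeasurableEquiv.sumPiEquivProdPi fun _ : Fin k ⊕ Fin (m - k) => X × ℤˣ).symm (v, u))
        (e (Sum.inr i)) = u i := by
    intro u i
    rw [MeasurableEquiv.coe_piCongrLeft, Equiv.piCongrLeft_apply_apply]
    rfl
  by_cases hv : v ∈ {v : Fin k → X × ℤˣ | CentersValid φ d c (List.ofFn v)} ∩ B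
  · rw [Set.indicator_of_mem hv]
    have : (compatProb φ d c μ (List.ofFn v)) ^ (m - k) = Measure.pi (fun _ : Fin (m - k) => μ)
        (Set.univ.pi fun _ => {z | CentersCompat φ d c (List.ofFn v) z}) := by
      rw [Measure.pi_pi]
      simp [compatProb]
    rw [this]
    congr 1
    ext u
    simp only [Set.mem_preimage, Function.comp_apply, selectionEvent, Set.mem_inter_iff,
      Set.mem_ofPred_eq, hl, Set.mem_pi, Set.mem_univ, forall_const]
    constructor
    · rintro ⟨⟨-, h⟩, -⟩ i
      simpa only [hrr] using h (e (Sum.inr i)) ((he2 _).2 ⟨i, rfl⟩)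
    · intro h
      refine ⟨⟨hv.1, fun j hj => ?_⟩, hv.2⟩
      obtain ⟨i, rfl⟩ := (he2 j).1 hj
      simpa only [hrr] using h i
  · rw [Set.indicator_of_notMem hv]
    convert measure_empty
    · ext u
      simp only [Set.mem_preimage, Function.comp_apply, selectionEvent, Set.mem_inter_iff,
        Set.mem_ofPred_eq, hl, Set.mem_empty_iff_false, iff_false]
      exact fun h => hv ⟨h.1.1, h.2⟩
    · infer_instance

end CenterProbabilities

/-! ### Comparison of sample sizes and the probability of a bad sample. -/

section Bounds

variable {X H : Type*} [NormedAddCommGroup H] {φ : X → H}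

theorem selectionEvent.valid_and_compat {d : ℕ} {c : X × ℤˣ} {k m : ℕ} {σ : Fin k ↪ Fin m}
    {w : Fin m → X × ℤˣ} (hw : w ∈ selectionEvent φ d c σ) :
    CentersValid φ d c (List.ofFn fun i => w (σ i)) ∧
      (∀ z ∈ List.ofFn fun i => w (σ i), z ∈ Set.range (withInitial c w)) ∧
      ∀ z ∈ Set.range (withInitial c w), CentersCompat φ d c (List.ofFn fun i => w (σ i)) z := by
  refine ⟨hw.1, fun z hz => ?_, ?_⟩
  · obtain ⟨i, rfl⟩ := List.mem_ofFn.1 hz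
    exact ⟨some (σ i), rfl⟩
  · rintro _ ⟨_ | j, rfl⟩
    · exact hw.1.compat_center
    · by_cases hj : j ∈ Set.range σ
      · obtain ⟨i, rfl⟩ := hj
        exact hw.1.compat_mem (List.mem_ofFn.2 ⟨i, rfl⟩)
      · exact hw.2 j hj

/-- In the absence of ties, the indices of the selected centers are unique. -/
theorem selectionEvent.unique {d : ℕ} {c : X × ℤˣ} {m : ℕ} {w : Fin m → X × ℤˣ}
    (hinj : Function.Injective (withInitial c w)) (hties : NoTies φ (Set.range (withInitial c w)))
    {k k' : ℕ} {σ : Fin k ↪ Fin m} {σ' : Fin k' ↪ Fin m} (hw : w ∈ selectionEvent φ d c σ)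
    (hw' : w ∈ selectionEvent φ d c σ') : k = k' ∧ HEq σ σ' := by
  obtain ⟨h1, h2, h3⟩ := selectionEvent.valid_and_compat hw
  obtain ⟨h1', h2', h3'⟩ := selectionEvent.valid_and_compat hw'
  have hL := h1.unique hties ⟨none, rfl⟩ h1' h2 h2' h3 h3'
  obtain rfl : k = k' := by simpa using congrArg List.length hL
  refine ⟨rfl, heq_of_eq ?_⟩
  ext i : 1
  have := congrFun (List.ofFn_injective hL) i
  exact Option.some_injective _ (hinj (a₁ := some (σ i)) (a₂ := some (σ' i)) this)

/-- In the absence of ties, some centers are selected, and they determine the output. -/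
theorem exists_selectionEvent [LinearOrder X] [MeasurableSpace X]
    (hφ : Measurable (fun p : X × X => ‖φ p.1 - φ p.2‖)) (μ : Measure (X × ℤˣ))
    [IsProbabilityMeasure μ] (d : ℕ) {c : X × ℤˣ} {m : ℕ} {w : Fin m → X × ℤˣ}
    (hinj : Function.Injective (withInitial c w))
    (hties : NoTies φ (Set.range (withInitial c w))) :
    ∃ (k : ℕ) (σ : Fin k ↪ Fin m), w ∈ selectionEvent φ d c σ ∧
      (gemCompression φ d c (trainingSet w)).card = k ∧
      gemRisk μ (gemPredictor φ d c (trainingSet w)) =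
        1 - (compatProb φ d c μ (List.ofFn fun i => w (σ i))).toReal := by
  have hmem : ∀ z, z ∈ c ::ₘ trainingSet w ↔ z ∈ Set.range (withInitial c w) := by
    intro z
    simp only [trainingSet, Multiset.mem_cons, Multiset.mem_map, Finset.mem_val, Finset.mem_univ,
      true_and, Set.mem_range, Option.exists, withInitial, eq_comm (a := z)]
  have hset : {z | z ∈ c ::ₘ trainingSet w} = Set.range (withInitial c w) := Set.ext hmem
  have hwinj : Function.Injective w := fun i j hij =>
    Option.some_injective _ (hinj (a₁ := some i) (a₂ := some j) hij)
  have hnd : (c ::ₘ trainingSet w).Nodup := by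
    refine Multiset.nodup_cons.2 ⟨fun h => ?_, Finset.univ.nodup.map hwinj⟩
    obtain ⟨i, -, hi⟩ := Multiset.mem_map.1 h
    exact absurd (hinj (a₁ := some i) (a₂ := none) hi) (by simp)
  obtain ⟨L, hL1, hL2, hL3, hL4, hL5⟩ := gemLoop_exists_centers d (c ::ₘ trainingSet w) c hnd
    (hset ▸ hties) (Multiset.mem_cons_self _ _)
  rw [Multiset.erase_cons_head] at hL1
  have hLw : ∀ i : Fin L.length, ∃ j, w j = L.get i := by
    intro i
    have := Multiset.mem_of_le hL1 (Multiset.mem_coe.2 (List.get_mem L i))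
    simpa [trainingSet] using this
  choose f hf using hLw
  have hLnd : L.Nodup := Multiset.coe_nodup.1
    (Multiset.nodup_of_le hL1 (Multiset.nodup_cons.1 hnd).2)
  have hfinj : Function.Injective f := fun i j hij =>
    hLnd.injective_get (by rw [← hf, ← hf, hij])
  have hofFn : List.ofFn (fun i => w (f i)) = L := by
    simp only [hf]
    exact List.ofFn_get L
  refine ⟨L.length, ⟨f, hfinj⟩, ⟨?_, fun j _ => ?_⟩, ?_, ?_⟩
  · simpa only [Function.Embedding.coeFn_mk, hofFn] using hL4
  · have := hL5 (w j) ((hmem _).2 ⟨some j, rfl⟩)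
    simpa only [Function.Embedding.coeFn_mk, hofFn] using this
  · rw [gemCompression, gemRun, hL2, Multiset.coe_card]
  · have hcompat : MeasurableSet {z | CentersCompat φ d c L z} := by
      have := measurableSet_centersCompat hφ d (A := X × ℤˣ) (measurable_const (a := c))
        measurable_id (v := fun i _ => L.get i) fun i => measurable_const
      simpa only [List.ofFn_get, id] using this
    have hloss : {z | gemLoss (gemPredictor φ d c (trainingSet w)) z = 1} =
        {z | CentersCompat φ d c L z}ᶜ := by
      ext z
      simp only [gemPredictor, gemRun, hL3]
      exact gemLoss_centersLabel d c L z
    rw [gemRisk, hloss, probReal_compl_eq_one_sub hcompat]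
    simp only [Function.Embedding.coeFn_mk, hofFn]
    rfl

variable [MeasurableSpace X]

theorem aedisjoint_selectionEvent (hφ : Measurable (fun p : X × X => ‖φ p.1 - φ p.2‖))
    (μ : Measure (X × ℤˣ)) [IsProbabilityMeasure μ]
    (hsphere : ∀ (c : H) (γ : ℝ), μ {w | ‖φ w.1 - c‖ ^ 2 = γ} = 0) (d : ℕ) (c : X × ℤˣ)
    (m K : ℕ) : Pairwise fun s t : Σ k : Fin K, Fin k ↪ Fin m =>
      AEDisjoint (Measure.pi fun _ : Fin m => μ) (selectionEvent φ d c s.2)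
        (selectionEvent φ d c t.2) := by
  rintro ⟨k, σ⟩ ⟨k', σ'⟩ hne
  refine measure_mono_null (fun w hw => ?_)
    (ae_iff.1 (ae_injective_noTies hφ μ hsphere c m))
  rintro ⟨hinj, hties⟩
  obtain ⟨h1, h2⟩ := selectionEvent.unique hinj hties hw.1 hw.2
  exact hne (Sigma.ext (Fin.ext h1) h2)

/-- The left side is the total probability of almost surely disjoint events for a fictitious sample
of size `m`, which need not be the size of the observed one. -/
theorem sum_descFactorial_mul_lintegral_le_one
    (hφ : Measurable (fun p : X × X => ‖φ p.1 - φ p.2‖))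
    (μ : Measure (X × ℤˣ)) [IsProbabilityMeasure μ]
    (hsphere : ∀ (c : H) (γ : ℝ), μ {w | ‖φ w.1 - c‖ ^ 2 = γ} = 0) (d : ℕ) (c : X × ℤˣ)
    (m K : ℕ) :
    ∑ k : Fin K, (m.descFactorial k : ℝ≥0∞) *
      ∫⁻ v in {v | CentersValid φ d c (List.ofFn v)},
        compatProb φ d c μ (List.ofFn v) ^ (m - k) ∂Measure.pi (fun _ : Fin k => μ) ≤ 1 := by
  have h := sum_measure_le_measure_univ (μ := Measure.pi fun _ : Fin m => μ)
    (s := (Finset.univ : Finset (Σ k : Fin K, Fin k ↪ Fin m)))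
    (t := fun s => selectionEvent φ d c s.2)
    (fun s _ => (measurableSet_selectionEvent hφ d c s.2).nullMeasurableSet)
    ((aedisjoint_selectionEvent hφ μ hsphere d c m K).set_pairwise _)
  rw [measure_univ, Fintype.sum_sigma] at h
  refine le_trans (le_of_eq (Finset.sum_congr rfl fun k _ => ?_)) h
  have hσ : ∀ σ : Fin k ↪ Fin m, Measure.pi (fun _ : Fin m => μ) (selectionEvent φ d c σ) =
      ∫⁻ v in {v | CentersValid φ d c (List.ofFn v)},
        compatProb φ d c μ (List.ofFn v) ^ (m - k) ∂Measure.pi (fun _ : Fin k => μ) := by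
    intro σ
    simpa using measure_selectionEvent_inter hφ d c μ σ MeasurableSet.univ
  simp only [hσ, Finset.sum_const, Finset.card_univ, Fintype.card_embedding_eq, Fintype.card_fin,
    nsmul_eq_mul]

/-- The centers for which the risk is not between the two bounds. -/
def badCenters (φ : X → H) (d : ℕ) (c : X × ℤˣ) (μ : Measure (X × ℤˣ)) (N : ℕ) (δ : ℝ) (k : ℕ) :
    Set (Fin k → X × ℤˣ) :=
  {v | ¬ (epsLower N δ k ≤ 1 - (compatProb φ d c μ (List.ofFn v)).toReal ∧
    1 - (compatProb φ d c μ (List.ofFn v)).toReal ≤ epsUpper N δ k)}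

theorem measurableSet_badCenters (hφ : Measurable (fun p : X × X => ‖φ p.1 - φ p.2‖))
    (d : ℕ) (c : X × ℤˣ) (μ : Measure (X × ℤˣ)) [IsProbabilityMeasure μ] (N : ℕ) (δ : ℝ) (k : ℕ) :
    MeasurableSet (badCenters φ d c μ N δ k) := by
  have h : Measurable fun v : Fin k → X × ℤˣ =>
      1 - (compatProb φ d c μ (List.ofFn v)).toReal :=
    measurable_const.sub (measurable_compatProb hφ d c μ k).ennreal_toReal
  exact ((measurableSet_le measurable_const h).inter
    (measurableSet_le h measurable_const)).compl

theorem descFactorial_mul_compatProb_pow_le {N : ℕ} (hN : 1 ≤ N) {δ : ℝ} (hδ : 0 < δ) (d : ℕ)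
    (c : X × ℤˣ) (μ : Measure (X × ℤˣ)) [IsProbabilityMeasure μ] {k : ℕ} (hk : k ≤ N)
    {v : Fin k → X × ℤˣ} (hv : v ∈ badCenters φ d c μ N δ k) :
    (N.descFactorial k : ℝ≥0∞) * compatProb φ d c μ (List.ofFn v) ^ (N - k) ≤
      ∑ m ∈ Finset.range N, ENNReal.ofReal (δ / (2 * N)) *
        ((m.descFactorial k : ℝ≥0∞) * compatProb φ d c μ (List.ofFn v) ^ (m - k)) +
      ∑ m ∈ Finset.Icc (N + 1) (4 * N), ENNReal.ofReal (δ / (6 * N)) *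
        ((m.descFactorial k : ℝ≥0∞) * compatProb φ d c μ (List.ofFn v) ^ (m - k)) := by
  have hp1 : compatProb φ d c μ (List.ofFn v) ≤ 1 := prob_le_one
  have hp : compatProb φ d c μ (List.ofFn v) =
      ENNReal.ofReal (compatProb φ d c μ (List.ofFn v)).toReal :=
    (ENNReal.ofReal_toReal (ne_top_of_le_ne_top ENNReal.one_ne_top hp1)).symm
  have hp0 : 0 ≤ (compatProb φ d c μ (List.ofFn v)).toReal := ENNReal.toReal_nonneg
  have h := ENNReal.ofReal_le_ofReal (descFactorial_mul_pow_le hN hδ hk hp0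
    (by simpa using ENNReal.toReal_mono ENNReal.one_ne_top hp1) hv)
  rw [hp]
  set q := (compatProb φ d c μ (List.ofFn v)).toReal
  have hterm : ∀ m : ℕ, ENNReal.ofReal ((m.descFactorial k : ℝ) * q ^ (m - k)) =
      (m.descFactorial k : ℝ≥0∞) * ENNReal.ofReal q ^ (m - k) := by
    intro m
    rw [ENNReal.ofReal_mul (Nat.cast_nonneg _), ENNReal.ofReal_natCast, ENNReal.ofReal_pow hp0]
  rwa [hterm, ENNReal.ofReal_add (by positivity) (by positivity),
    ENNReal.ofReal_mul (by positivity), ENNReal.ofReal_mul (by positivity),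
    ENNReal.ofReal_sum_of_nonneg fun m _ => by positivity,
    ENNReal.ofReal_sum_of_nonneg fun m _ => by positivity, Finset.mul_sum, Finset.mul_sum,
    Finset.sum_congr rfl fun m _ => congrArg _ (hterm m),
    Finset.sum_congr (s₁ := Finset.Icc _ _) rfl fun m _ => congrArg _ (hterm m)] at h

/-- The samples whose selected centers are bad. -/
def badSamples (φ : X → H) (d : ℕ) (c : X × ℤˣ) (μ : Measure (X × ℤˣ)) (N : ℕ) (δ : ℝ) :
    Set (Fin N → X × ℤˣ) :=
  ⋃ s : Σ k : Fin (N + 1), Fin k ↪ Fin N,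
    selectionEvent φ d c s.2 ∩ {w | (fun i => w (s.2 i)) ∈ badCenters φ d c μ N δ s.1}

theorem measurableSet_badSamples (hφ : Measurable (fun p : X × X => ‖φ p.1 - φ p.2‖))
    (d : ℕ) (c : X × ℤˣ) (μ : Measure (X × ℤˣ)) [IsProbabilityMeasure μ] (N : ℕ) (δ : ℝ) :
    MeasurableSet (badSamples φ d c μ N δ) :=
  MeasurableSet.iUnion fun s => (measurableSet_selectionEvent hφ d c s.2).inter
    (measurable_pi_lambda (fun (w : Fin N → X × ℤˣ) i => w (s.2 i))
      (fun _ => measurable_pi_apply _) (measurableSet_badCenters hφ d c μ N δ s.1))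

theorem measure_badSamples_le (hφ : Measurable (fun p : X × X => ‖φ p.1 - φ p.2‖))
    (μ : Measure (X × ℤˣ)) [IsProbabilityMeasure μ]
    (hsphere : ∀ (c : H) (γ : ℝ), μ {w | ‖φ w.1 - c‖ ^ 2 = γ} = 0) (d : ℕ) (c : X × ℤˣ)
    {N : ℕ} (hN : 1 ≤ N) {δ : ℝ} (hδ : 0 < δ) :
    Measure.pi (fun _ : Fin N => μ) (badSamples φ d c μ N δ) ≤ ENNReal.ofReal δ := by
  set I : ℕ → ℕ → ℝ≥0∞ := fun m k => (m.descFactorial k : ℝ≥0∞) *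
      ∫⁻ v in {v | CentersValid φ d c (List.ofFn v)},
        compatProb φ d c μ (List.ofFn v) ^ (m - k) ∂Measure.pi (fun _ : Fin k => μ) with hI
  have hpow : ∀ k n : ℕ, Measurable fun v : Fin k → X × ℤˣ =>
      compatProb φ d c μ (List.ofFn v) ^ n := fun k n => (measurable_compatProb hφ d c μ k).pow_const n
  have hk : ∀ k : Fin (N + 1), ∑ σ : Fin k ↪ Fin N, Measure.pi (fun _ : Fin N => μ)
      (selectionEvent φ d c σ ∩ {w | (fun i => w (σ i)) ∈ badCenters φ d c μ N δ k}) ≤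
      ∑ m ∈ Finset.range N, ENNReal.ofReal (δ / (2 * N)) * I m k +
      ∑ m ∈ Finset.Icc (N + 1) (4 * N), ENNReal.ofReal (δ / (6 * N)) * I m k := by
    intro k
    have hB := measurableSet_badCenters hφ d c μ N δ k
    have hV : MeasurableSet {v : Fin k → X × ℤˣ | CentersValid φ d c (List.ofFn v)} :=
      measurableSet_centersValid hφ d measurable_const measurable_pi_apply
    simp only [measure_selectionEvent_inter hφ d c μ _ hB, Finset.sum_const, Finset.card_univ,
      Fintype.card_embedding_eq, Fintype.card_fin, nsmul_eq_mul]
    rw [← lintegral_const_mul _ (hpow _ _)]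
    calc _ ≤ ∫⁻ v in {v | CentersValid φ d c (List.ofFn v)} ∩ badCenters φ d c μ N δ k,
          (∑ m ∈ Finset.range N, ENNReal.ofReal (δ / (2 * N)) *
            ((m.descFactorial k : ℝ≥0∞) * compatProb φ d c μ (List.ofFn v) ^ (m - k)) +
          ∑ m ∈ Finset.Icc (N + 1) (4 * N), ENNReal.ofReal (δ / (6 * N)) *
            ((m.descFactorial k : ℝ≥0∞) * compatProb φ d c μ (List.ofFn v) ^ (m - k)))
            ∂Measure.pi (fun _ : Fin k => μ) :=
          setLIntegral_mono' (hV.inter hB) fun v hv =>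
            descFactorial_mul_compatProb_pow_le hN hδ d c μ (Nat.lt_succ_iff.1 k.2) hv.2
      -- The restriction to bad centers is dropped here: the right side then consists of the
      -- integrals controlled at the sizes `m ≠ N`.
      _ ≤ ∫⁻ v in {v | CentersValid φ d c (List.ofFn v)},
          (∑ m ∈ Finset.range N, ENNReal.ofReal (δ / (2 * N)) *
            ((m.descFactorial k : ℝ≥0∞) * compatProb φ d c μ (List.ofFn v) ^ (m - k)) +
          ∑ m ∈ Finset.Icc (N + 1) (4 * N), ENNReal.ofReal (δ / (6 * N)) *
            ((m.descFactorial k : ℝ≥0∞) * compatProb φ d c μ (List.ofFn v) ^ (m - k)))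
            ∂Measure.pi (fun _ : Fin k => μ) := lintegral_mono_set Set.inter_subset_left
      _ = _ := by
          have hm : ∀ (a : ℝ≥0∞) (m : ℕ), Measurable fun v : Fin k → X × ℤˣ =>
              a * ((m.descFactorial k : ℝ≥0∞) * compatProb φ d c μ (List.ofFn v) ^ (m - k)) :=
            fun a m => ((hpow _ _).const_mul _).const_mul _
          rw [lintegral_add_left (Finset.measurable_fun_sum _ fun m _ => hm _ m),
            lintegral_finsetSum _ fun m _ => hm _ m, lintegral_finsetSum _ fun m _ => hm _ m]
          simp only [hI, lintegral_const_mul _ ((hpow _ _).const_mul _),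
            lintegral_const_mul _ (hpow _ _)]
  have hsum : ∀ (a : ℝ≥0∞) (s : Finset ℕ), ∑ k : Fin (N + 1), ∑ m ∈ s, a * I m k ≤ s.card * a := by
    intro a s
    rw [Finset.sum_comm, ← nsmul_eq_mul, ← Finset.sum_const]
    refine Finset.sum_le_sum fun m _ => ?_
    rw [← Finset.mul_sum]
    exact mul_le_of_le_one_right' (sum_descFactorial_mul_lintegral_le_one hφ μ hsphere d c m (N + 1))
  calc _ ≤ ∑ s : Σ k : Fin (N + 1), Fin k ↪ Fin N, Measure.pi (fun _ : Fin N => μ)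
        (selectionEvent φ d c s.2 ∩ {w | (fun i => w (s.2 i)) ∈ badCenters φ d c μ N δ s.1}) :=
        measure_iUnion_fintype_le _ _
    _ ≤ ∑ k : Fin (N + 1), (∑ m ∈ Finset.range N, ENNReal.ofReal (δ / (2 * N)) * I m k +
        ∑ m ∈ Finset.Icc (N + 1) (4 * N), ENNReal.ofReal (δ / (6 * N)) * I m k) := by
        rw [Fintype.sum_sigma]
        exact Finset.sum_le_sum fun k _ => hk k
    -- There are `N` sizes below `N` and `3 * N` above it up to `4 * N`, each contributing at most
    -- its weight; both groups give `δ / 2`.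
    _ ≤ N * ENNReal.ofReal (δ / (2 * N)) + (3 * N : ℕ) * ENNReal.ofReal (δ / (6 * N)) := by
        rw [Finset.sum_add_distrib]
        refine add_le_add ((hsum _ _).trans_eq (by rw [Finset.card_range]))
          ((hsum _ _).trans_eq ?_)
        rw [Nat.card_Icc, show 4 * N + 1 - (N + 1) = 3 * N by omega]
    _ = ENNReal.ofReal δ := by
        have hN' : (0 : ℝ) < N := by exact_mod_cast hN
        rw [← ENNReal.ofReal_natCast, ← ENNReal.ofReal_natCast, ← ENNReal.ofReal_mul (by positivity),
          ← ENNReal.ofReal_mul (by positivity), ← ENNReal.ofReal_add (by positivity) (by positivity)]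
        congr 1
        push_cast
        field_simp
        norm_num

/-- The selection is unique here, so the output of GEM is read off from it. This replaces an event
defined through the algorithm by a measurable one. -/
theorem gemBoundsHold_iff_notMem_badSamples [LinearOrder X]
    (hφ : Measurable (fun p : X × X => ‖φ p.1 - φ p.2‖)) (μ : Measure (X × ℤˣ))
    [IsProbabilityMeasure μ] (d : ℕ) {c : X × ℤˣ} {N : ℕ} {w : Fin N → X × ℤˣ} (δ : ℝ)
    (hinj : Function.Injective (withInitial c w))
    (hties : NoTies φ (Set.range (withInitial c w))) :
    GemBoundsHold φ d c μ δ w ↔ w ∉ badSamples φ d c μ N δ := by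
  obtain ⟨k, σ, hσ, hcard, hrisk⟩ := exists_selectionEvent hφ μ d hinj hties
  rw [GemBoundsHold, hcard, hrisk]
  have hkN : k < N + 1 := by
    have := Fintype.card_le_of_embedding σ
    simp only [Fintype.card_fin] at this
    omega
  constructor
  · intro h hw
    obtain ⟨⟨⟨k', hk'⟩, σ'⟩, hw1, hw2⟩ := Set.mem_iUnion.1 hw
    obtain ⟨rfl, h2⟩ := selectionEvent.unique hinj hties hσ hw1
    obtain rfl := eq_of_heq h2
    exact hw2 h
  · intro h
    by_contra hbad
    exact h (Set.mem_iUnion.2 ⟨⟨⟨k, hkN⟩, σ⟩, hσ, hbad⟩)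

end Bounds

/-! ### Transfer to the given probability space. -/

theorem mainTheorem12
    {X H Ω : Type*} [MeasurableSpace X] [LinearOrder X]
    [NormedAddCommGroup H] [InnerProductSpace ℝ H] [CompleteSpace H]
    [MeasurableSpace Ω] (Pr : Measure Ω) [IsProbabilityMeasure Pr]
    (φ : X → H) (hφ : Measurable (fun p : X × X => ‖φ p.1 - φ p.2‖))
    (d : ℕ) (hd : 1 ≤ d) (zbar : X × ℤˣ)
    (N : ℕ) (hN : 1 ≤ N)
    (μ : Measure (X × ℤˣ)) (z : Fin N → Ω → X × ℤˣ)
    (hz : ∀ i, Measurable (z i)) (hindep : iIndepFun z Pr) (hlaw : ∀ i, Pr.map (z i) = μ)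
    (hsphere : ∀ (c : H) (γ : ℝ), μ {w | ‖φ w.1 - c‖ ^ 2 = γ} = 0)
    (δ : ℝ) (hδ0 : 0 < δ) (hδ1 : δ < 1) :
    NullMeasurableSet {ω | GemBoundsHold φ d zbar μ δ (fun i => z i ω)} Pr ∧
      1 - δ ≤ Pr.real {ω | GemBoundsHold φ d zbar μ δ (fun i => z i ω)} := by
 
  have hμ : IsProbabilityMeasure μ := by
    rw [← hlaw ⟨0, hN⟩]
    exact Measure.isProbabilityMeasure_map (hz _).aemeasurable
  have hW : Measurable fun ω i => z i ω := measurable_pi_lambda _ hz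
  have hmap : Pr.map (fun ω i => z i ω) = Measure.pi fun _ : Fin N => μ := by
    rw [(iIndepFun_iff_map_fun_eq_pi_map fun i => (hz i).aemeasurable).1 hindep]
    simp only [hlaw]
  have hU := measurableSet_badSamples hφ d zbar μ N δ
  -- The two events differ only where ties or repetitions occur, a null set; this gives both the
  -- null measurability and the probability.
  have hae : {ω | GemBoundsHold φ d zbar μ δ (fun i => z i ω)} =ᵐ[Pr]
      ((fun ω i => z i ω) ⁻¹' badSamples φ d zbar μ N δ)ᶜ := by
    have h := ae_injective_noTies hφ μ hsphere zbar N
    rw [← hmap] at h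
    filter_upwards [ae_of_ae_map hW.aemeasurable h] with ω hω
    exact propext (gemBoundsHold_iff_notMem_badSamples hφ μ d δ hω.1 hω.2)
  refine ⟨(hW hU).compl.nullMeasurableSet.congr hae.symm, ?_⟩
  have hreal : Pr.real {ω | GemBoundsHold φ d zbar μ δ (fun i => z i ω)} =
      Pr.real ((fun ω i => z i ω) ⁻¹' badSamples φ d zbar μ N δ)ᶜ := measureReal_congr hae
  rw [hreal, probReal_compl_eq_one_sub (hW hU), measureReal_def,
    ← Measure.map_apply hW hU, hmap]
  have := ENNReal.toReal_mono ENNReal.ofReal_ne_top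
    (measure_badSamples_le hφ μ hsphere d zbar hN hδ0)
  rw [ENNReal.toReal_ofReal hδ0.le] at this
  linarith
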